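/- **Setting.** Let $\mathcal A,\mathcal Z$ be finite sets with $|\mathcal A|\ge 2$, $|\mathcal Z|\ge 1$, and fix a linear order on $\mathcal A$. An environment is a family $\nu=(\nu_a)_{a\in\mathcal A}$ of probability measures on $\mathcal Z\times[0,1]$; write $\nu_a(z)$ for the probability that the $\mathcal Z$-coordinate under $\nu_a$ equals $z$, and $\mu_a$ for the mean of the $[0,1]$-coordinate. In rounds $t=1,\dots,T$ the pairs $(Z_t(a),Y_t(a))\sim\nu_a$, $a\in\mathcal A$, are drawn independently over $a$ and $t$; an algorithm $\pi$ chooses $A_t\in\mathcal A$ as a function of $(A_s,Z_s,Y_s)_{s<t}$ and observes only $Z_t=Z_t(A_t)$, $Y_t=Y_t(A_t)$. Its regret is $R_{\nu,\pi}(T)=T\max_a\mu_a-\mathbb E\sum_{t=1}^T\mu_{A_t}$. For $\delta>0$ put $N_t(a)=1\vee\sum_{s\le t}\mathbf 1\{A_s=a\}$, $N_t(z)=1\vee\sum_{s\le t}\mathbf 1\{Z_s=z\}$, $$U_t(a)=\frac{\sum_{s\le t}Y_s\mathbf 1\{A_s=a\}}{N_t(a)}+\sqrt{\frac{\log(2/\delta)}{2N_t(a)}},\qquad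 U_t(z)=\frac{\sum_{s\le t}Y_s\mathbf 1\{Z_s=z\}}{N_t(z)}+\sqrt{\frac{\log(2/\delta)}{2N_t(z)}},$$ and, for given (approximate) marginals $q=(q_a(z))$, $\widetilde U_t(a)=\sum_z U_t(z)\,q_a(z)$. UCB plays $A_{t+1}=\arg\max_a U_t(a)$ and C-UCB with marginals $q$ plays $A_{t+1}=\arg\max_a\widetilde U_t(a)$, the least maximizer in the order on $\mathcal A$ in case of ties. HAC-UCB with horizon $T$ and marginals $q$ uses $\delta=2/T^2$ throughout. Put $\sigma_T=T^{-1/4}\sqrt{|\mathcal A||\mathcal Z|\log T}$. 1. Play each action $\lceil 4\sqrt T/|\mathcal A|\rceil$ times, in blocks in increasing order of the actions, and let $\hat q_a(z)$ be the empirical frequency of $z$ in the rounds where $a$ was played. If $\max_a\sum_z|q_a(z)-\hat q_a(z)|>2\sigma_T$, replace $q$ by $\hat q$. 2. Play each action $\lceil\sqrt T/|\mathcal A|\rceil$ times, in blocks in the same order. 3. In each later round $t\le T$, as long as all earlier tests have passed, test whether for every $a\in\mathcal A$ $$-2\sum_z\sqrt{\tfrac{\log T}{N_{t-1}(z)}}\,q_a(z)\le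 U_{t-1}(a)-\widetilde U_{t-1}(a)+\sigma_T\le 2\sqrt{\tfrac{\log T}{N_{t-1}(a)}}+2\sigma_T .$$ If so, play the action of C-UCB; once the test has failed, play the action of UCB in this and all remaining rounds ("switch to UCB"). **Theorem.** There is a constant $C>0$ such that for all finite $\mathcal A,\mathcal Z$ with $|\mathcal A|\ge2$, $|\mathcal Z|\ge1$, and every linear order on $\mathcal A$, there is an environment $\nu$ with the following properties. (i) For every choice of confidence parameters $\delta_T\in(0,1)$, $T\in\mathbb N$, C-UCB with the exact marginals $q_a(z)=\nu_a(z)$ and parameter $\delta_T$ at horizon $T$ satisfies $$\liminf_{T\to\infty}\frac{R_{\nu,\text{C-UCB}}(T)}{T}\ \ge\ \frac1C .$$ (ii) For HAC-UCB with horizon $T$ and the exact marginals $q_a(z)=\nu_a(z)$, the probability that it switches to UCB within the $T$ rounds tends to $1$ as $T\to\infty$, and $$\limsup_{T\to\infty}\frac{R_{\nu,\text{HAC-UCB}}(T)}{|\mathcal A|+|\mathcal Z|+\sqrt{|\mathcal A|\,T\log T}+(\log T)\sqrt T}\ \le\ C .$$ -/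

import Mathlib

open Filter Topology MeasureTheory

noncomputable section

namespace CausalBandit

variable {A Z : Type*}

/-- The observation of one round: the action played, the post-action context and the reward
in `[0,1]`. -/
abbrev Obs (A Z : Type*) := A × Z × unitInterval

/-- A (deterministic) policy: `π t` maps the history of the first `t` rounds to the action of the
next round. -/
abbrev Policy (A Z : Type*) := ∀ t : ℕ, (Fin t → Obs A Z) → A

/-- An environment: for every action a joint law of post-action context and reward. -/
abbrev Env (A Z : Type*) [MeasurableSpace Z] := A → ProbabilityMeasure (Z × unitInterval)

section Interaction

/-- The history of the first `t` rounds when `π` is played against the potential outcomes `ω`;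
`ω t a` is the pair (context, reward) that action `a` would produce in the round with (zero-based)
index `t`. -/
def history (π : Policy A Z) (ω : ℕ → A → Z × unitInterval) : ∀ t : ℕ, Fin t → Obs A Z
  | 0 => Fin.elim0
  | t + 1 =>
      Fin.snoc (α := fun _ => Obs A Z) (history π ω t)
        (π t (history π ω t), ω t (π t (history π ω t)))

/-- The action played in the round with (zero-based) index `t`. -/
def action (π : Policy A Z) (ω : ℕ → A → Z × unitInterval) (t : ℕ) : A :=
  π t (history π ω t)

variable [MeasurableSpace Z]

/-- The law of the potential outcomes: independent over rounds and actions, with the outcome of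
action `a` in each round distributed according to `ν a`. -/
def outcomeLaw [Fintype A] (ν : Env A Z) : Measure (ℕ → A → Z × unitInterval) :=
  Measure.infinitePi fun _ : ℕ => Measure.pi fun a => (ν a : Measure (Z × unitInterval))

/-- The mean reward of action `a`. -/
def meanReward (ν : Env A Z) (a : A) : ℝ :=
  ∫ x, (x.2 : ℝ) ∂(ν a : Measure (Z × unitInterval))

/-- The exact marginal probability that action `a` produces the post-action context `z`. -/
def marginal (ν : Env A Z) (a : A) (z : Z) : ℝ :=
  (ν a : Measure (Z × unitInterval)).real (Prod.fst ⁻¹' {z})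

/-- The regret of `π` over `T` rounds in the environment `ν`. -/
def regret [Fintype A] [Nonempty A] (ν : Env A Z) (π : Policy A Z) (T : ℕ) : ℝ :=
  T * Finset.univ.sup' Finset.univ_nonempty (meanReward ν)
    - ∫ ω, ∑ t ∈ Finset.range T, meanReward ν (action π ω t) ∂(outcomeLaw ν)

end Interaction

section Estimators

variable {t : ℕ}

/-- Number of rounds in which `a` was played, but at least `1`. -/
def numAct [DecidableEq A] (h : Fin t → Obs A Z) (a : A) : ℝ :=
  max 1 (∑ i, if (h i).1 = a then 1 else 0)

/-- Number of rounds in which `z` was observed, but at least `1`. -/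
def numCtx [DecidableEq Z] (h : Fin t → Obs A Z) (z : Z) : ℝ :=
  max 1 (∑ i, if (h i).2.1 = z then 1 else 0)

/-- Empirical mean reward of the action `a`. -/
def meanAct [DecidableEq A] (h : Fin t → Obs A Z) (a : A) : ℝ :=
  (numAct h a)⁻¹ * ∑ i, if (h i).1 = a then ((h i).2.2 : ℝ) else 0

/-- Empirical mean reward given that `z` was observed. -/
def meanCtx [DecidableEq Z] (h : Fin t → Obs A Z) (z : Z) : ℝ :=
  (numCtx h z)⁻¹ * ∑ i, if (h i).2.1 = z then ((h i).2.2 : ℝ) else 0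

/-- Upper confidence bound of the action `a` with confidence parameter `δ`. -/
def ucbAct [DecidableEq A] (δ : ℝ) (h : Fin t → Obs A Z) (a : A) : ℝ :=
  meanAct h a + √(Real.log (2 / δ) / (2 * numAct h a))

/-- Upper confidence bound of the context `z` with confidence parameter `δ`. -/
def ucbCtx [DecidableEq Z] (δ : ℝ) (h : Fin t → Obs A Z) (z : Z) : ℝ :=
  meanCtx h z + √(Real.log (2 / δ) / (2 * numCtx h z))

/-- Pseudo upper confidence bound of the action `a`: the upper confidence bounds of the contexts,
averaged with the (approximate) marginals `q a`. -/
def pseudoUcb [Fintype Z] [DecidableEq Z] (q : A → Z → ℝ) (δ : ℝ) (h : Fin t → Obs A Z)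
    (a : A) : ℝ :=
  ∑ z, ucbCtx δ h z * q a z

/-- Empirical distribution (maximum likelihood estimate) of the context under the action `a`, from
the rounds among the first `m` in which `a` was played. -/
def estMarginal [DecidableEq A] [DecidableEq Z] (m : ℕ) (h : Fin t → Obs A Z) (a : A) (z : Z) :
    ℝ :=
  (∑ i, if i.val < m ∧ (h i).1 = a ∧ (h i).2.1 = z then 1 else 0) /
    (∑ i, if i.val < m ∧ (h i).1 = a then 1 else 0)

end Estimators

section Algorithms

variable [Fintype A] [LinearOrder A] [Nonempty A]

open Classical in
/-- The maximizer of `f`; ties are broken by the order on `A`, in favour of the smallest. -/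
def argmax (f : A → ℝ) : A :=
  (Finset.univ.filter fun a => ∀ b, f b ≤ f a).min' (by
    obtain ⟨a, ha⟩ := Finite.exists_max f
    exact ⟨a, by simpa using ha⟩)

/-- The upper confidence bound algorithm UCB. -/
def ucb (δ : ℝ) : Policy A Z := fun _ h => argmax (ucbAct δ h)

variable [Fintype Z] [DecidableEq Z]

/-- The causal upper confidence bound algorithm C-UCB with marginals `q`. -/
def cucb (q : A → Z → ℝ) (δ : ℝ) : Policy A Z := fun _ h => argmax (pseudoUcb q δ h)

/-- Rounds per action in the first exploration phase of HAC-UCB. -/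
def explore₁ (A : Type*) [Fintype A] (T : ℕ) : ℕ := ⌈4 * √(T : ℝ) / Fintype.card A⌉₊

/-- Rounds per action in the second exploration phase of HAC-UCB. -/
def explore₂ (A : Type*) [Fintype A] (T : ℕ) : ℕ := ⌈√(T : ℝ) / Fintype.card A⌉₊

/-- Total length of the first exploration phase. -/
def phase₁ (A : Type*) [Fintype A] (T : ℕ) : ℕ := explore₁ A T * Fintype.card A

/-- Total length of the second exploration phase. -/
def phase₂ (A : Type*) [Fintype A] (T : ℕ) : ℕ := explore₂ A T * Fintype.card A

/-- The quantity `T^{-1/4} √(|A| |Z| log T)`. -/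
def slack (A Z : Type*) [Fintype A] [Fintype Z] (T : ℕ) : ℝ :=
  √(Fintype.card A * Fintype.card Z * Real.log T) / (T : ℝ) ^ (1 / 4 : ℝ)

open Classical in
/-- The marginals that HAC-UCB uses after its first exploration phase: the given `q`, unless for
some action its `ℓ¹` distance to the estimate from that phase exceeds
`2 T^{-1/4} √(|A| |Z| log T)`; in that case the estimate. -/
def hacMarginal (q : A → Z → ℝ) (T : ℕ) {t : ℕ} (h : Fin t → Obs A Z) : A → Z → ℝ :=
  if ∃ a, 2 * slack A Z T < ∑ z, |q a z - estMarginal (phase₁ A T) h a z| then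
    estMarginal (phase₁ A T) h
  else q

/-- The test of HAC-UCB: both conditions hold for every action, given the marginals `q` in use and
the history `h`. -/
def hacTest (q : A → Z → ℝ) (T : ℕ) {t : ℕ} (h : Fin t → Obs A Z) : Prop :=
  ∀ a : A,
    -2 * ∑ z, √(Real.log T / numCtx h z) * q a z
        ≤ ucbAct (2 / (T : ℝ) ^ 2) h a - pseudoUcb q (2 / (T : ℝ) ^ 2) h a + slack A Z T ∧
    ucbAct (2 / (T : ℝ) ^ 2) h a - pseudoUcb q (2 / (T : ℝ) ^ 2) h a + slack A Z T
        ≤ 2 * √(Real.log T / numAct h a) + 2 * slack A Z T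

/-- The flag of HAC-UCB after the history `h`, the test of the coming round included: it is true
iff the test has passed in every round since the end of the exploration. -/
def hacFlag (q : A → Z → ℝ) (T : ℕ) {t : ℕ} (h : Fin t → Obs A Z) : Prop :=
  ∀ (s : ℕ) (hs : s ≤ t), phase₁ A T + phase₂ A T ≤ s →
    hacTest (hacMarginal q T h) T fun i : Fin s => h (Fin.castLE hs i)

open Classical in
/-- The algorithm HAC-UCB with horizon `T` and (approximate) marginals `q`. The two exploration
phases play the actions in blocks, in increasing order; the confidence parameter of UCB and C-UCB
is `2 / T ^ 2`. -/
def hac (q : A → Z → ℝ) (T : ℕ) : Policy A Z := fun t h =>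
  if h₁ : t < phase₁ A T then
    monoEquivOfFin A rfl ⟨t / explore₁ A T, Nat.div_lt_of_lt_mul h₁⟩
  else if h₂ : t - phase₁ A T < phase₂ A T then
    monoEquivOfFin A rfl ⟨(t - phase₁ A T) / explore₂ A T, Nat.div_lt_of_lt_mul h₂⟩
  else if hacFlag q T h then
    cucb (hacMarginal q T h) (2 / (T : ℝ) ^ 2) t h
  else
    ucb (2 / (T : ℝ) ^ 2) t h

/-- On the outcomes `ω`, HAC-UCB with horizon `T` has switched to UCB by round `T`. -/
def hacSwitches (q : A → Z → ℝ) (T : ℕ) (ω : ℕ → A → Z × unitInterval) : Prop :=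
  ∃ t < T, ¬ hacFlag q T (history (hac q T) ω t)

end Algorithms

end CausalBandit

end

open CausalBandit

namespace CausalBandit

open ProbabilityTheory

/-! ### Trajectories, tie-breaking and measurability -/

section

variable {A Z : Type*}

section Histories

/-! The failure of C-UCB comes from contexts that carry no information. Let the context be uniform
and independent of the reward under every action, let the least action `a₀` have rewards in `[0,
1/8]`, and let all other actions share one reward law on `[7/8, 1]`. The marginals coincide, so the
pseudo upper confidence bounds tie whatever the data and the confidence parameter. Tie-breaking then
selects `a₀` forever, at a cost of at least 3/4 per round.

HAC-UCB notices this at its first test. Exploration plays each action `n` times, with `n` of order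
`√T`. The estimates given a context pool all actions; if the context frequencies of two actions
differ by at most a factor 3, at least a quarter of the observations of each context have reward at
least 7/8, so every context mean is at least 7/32 (`le_meanCtx`). This survives averaging with any
probability vector, so it does not matter whether the marginals were replaced by estimates. The
action mean of `a₀` is at most 1/8, and for large `T` the confidence radii and the slack are smaller
than the gap 3/32, so the test fails (`GoodOutcome.not_hacTest`). After the switch UCB avoids `a₀`,
because the reward ranges are separated (`GoodOutcome.action_hac_ne`).

The reward bounds hold almost surely, so only the context counts of the exploration need
concentration. Chebyshev bounds the failure probability by `K / √T`
(`IsUninformative.exists_measureReal_le`), which adds at most `K √T` to the regret. With the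
exploration length `5 √T + 2 |A|`, this is eventually at most `2 |A| + (log T) √T`, although `K`
depends on the environment. -/

theorem history_apply (π : Policy A Z) (ω : ℕ → A → Z × unitInterval) {t : ℕ} (i : Fin t) :
    history π ω t i = (action π ω i, ω i (action π ω i)) := by
  induction t with
  | zero => exact i.elim0
  | succ t ih =>
    refine Fin.lastCases ?_ (fun j => ?_) i
    · simp [history, action]
    · simp [history, ih]

theorem history_castLE (π : Policy A Z) (ω : ℕ → A → Z × unitInterval) {s t : ℕ} (hs : s ≤ t) :
    (fun i : Fin s => history π ω t (Fin.castLE hs i)) = history π ω s := by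
  funext i
  simp [history_apply]

theorem sum_history {M : Type*} [AddCommMonoid M] (π : Policy A Z)
    (ω : ℕ → A → Z × unitInterval) (t : ℕ) (f : ℕ → Obs A Z → M) :
    ∑ i : Fin t, f i (history π ω t i) =
      ∑ s ∈ Finset.range t, f s (action π ω s, ω s (action π ω s)) := by
  simp only [history_apply]
  exact Fin.sum_univ_eq_sum_range (fun s => f s (action π ω s, ω s (action π ω s))) t

end Histories

section Argmax

variable [Fintype A] [LinearOrder A] [Nonempty A]

theorem le_apply_argmax (f : A → ℝ) (b : A) : f b ≤ f (argmax f) := by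
  classical
  have h := Finset.min'_mem (Finset.univ.filter fun a => ∀ b, f b ≤ f a) (by
    obtain ⟨a, ha⟩ := Finite.exists_max f
    exact ⟨a, by simpa using ha⟩)
  exact (Finset.mem_filter.1 h).2 b

theorem argmax_le (f : A → ℝ) {a : A} (ha : ∀ b, f b ≤ f a) : argmax f ≤ a := by
  classical
  exact Finset.min'_le _ _ (by simpa using ha)

theorem argmax_eq_iff (f : A → ℝ) (a : A) :
    argmax f = a ↔ (∀ b, f b ≤ f a) ∧ ∀ c, (∀ b, f b ≤ f c) → a ≤ c := by
  constructor
  · rintro rfl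
    exact ⟨le_apply_argmax f, fun c hc => argmax_le f hc⟩
  · rintro ⟨h₁, h₂⟩
    exact le_antisymm (argmax_le f h₁) (h₂ _ (le_apply_argmax f))

theorem argmax_ne_of_lt (f : A → ℝ) {a b : A} (h : f a < f b) : argmax f ≠ a := by
  rintro rfl
  exact (le_apply_argmax f b).not_gt h

variable [Fintype Z] [DecidableEq Z]

/-- If all actions have the same marginals, then C-UCB always plays the least action. -/
theorem action_cucb_eq_of_isLeast {q : A → Z → ℝ} {a₀ : A} (h₀ : ∀ a, a₀ ≤ a)
    (hq : ∀ a b, q a = q b) (δ : ℝ) (ω : ℕ → A → Z × unitInterval) (t : ℕ) :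
    action (cucb q δ) ω t = a₀ := by
  refine (argmax_eq_iff _ _).2 ⟨fun b => ?_, fun c _ => h₀ c⟩
  simp only [pseudoUcb, hq b a₀, le_refl]

end Argmax

section Measurability

theorem measurableSet_setOf_forall {ι : Sort*} [Countable ι] {X : Type*} [MeasurableSpace X]
    {p : ι → X → Prop} (hp : ∀ i, MeasurableSet {x | p i x}) :
    MeasurableSet {x | ∀ i, p i x} := by
  rw [Set.ofPred_forall]
  exact MeasurableSet.iInter hp

theorem measurableSet_setOf_exists {ι : Sort*} [Countable ι] {X : Type*} [MeasurableSpace X]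
    {p : ι → X → Prop} (hp : ∀ i, MeasurableSet {x | p i x}) :
    MeasurableSet {x | ∃ i, p i x} := by
  rw [Set.ofPred_exists]
  exact MeasurableSet.iUnion hp

variable [MeasurableSpace A] [MeasurableSpace Z]

/-- Measurability of the trajectory makes the collected mean reward integrable, without which its
integral could not be compared with pointwise bounds. -/
theorem measurable_history [Countable A] [MeasurableSingletonClass A] {π : Policy A Z}
    (hπ : ∀ t, Measurable (π t)) (t : ℕ) :
    Measurable fun ω : ℕ → A → Z × unitInterval => history π ω t := by
  have hact : ∀ t, (Measurable fun ω : ℕ → A → Z × unitInterval => history π ω t) →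
      Measurable fun ω : ℕ → A → Z × unitInterval => ω t (action π ω t) := by
    intro t ht
    -- The coordinate read off is itself random. With countably many actions, joint measurability
    -- follows from measurability for each fixed action.
    have hev : Measurable fun x : A × (ℕ → A → Z × unitInterval) => x.2 t x.1 :=
      measurable_from_prod_countable_right fun a =>
        (measurable_pi_apply a).comp (measurable_pi_apply t)
    exact hev.comp (((hπ t).comp ht).prodMk measurable_id)
  induction t with
  | zero => exact measurable_pi_iff.2 fun i => i.elim0
  | succ t ih =>
    refine measurable_pi_iff.2 fun i => ?_
    refine Fin.lastCases ?_ (fun j => ?_) i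
    · simp only [history, Fin.snoc_last]
      exact ((hπ t).comp ih).prodMk (hact t ih)
    · simp only [history, Fin.snoc_castSucc]
      exact (measurable_pi_apply j).comp ih

theorem measurable_action [Countable A] [MeasurableSingletonClass A] {π : Policy A Z}
    (hπ : ∀ t, Measurable (π t)) (t : ℕ) :
    Measurable fun ω : ℕ → A → Z × unitInterval => action π ω t :=
  (hπ t).comp (measurable_history hπ t)

variable {t : ℕ}

theorem measurableSet_act_eq [MeasurableSingletonClass A] (i : Fin t) (a : A) :
    MeasurableSet {h : Fin t → Obs A Z | (h i).1 = a} :=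
  (measurable_fst.comp (measurable_pi_apply i)) (measurableSet_singleton a)

theorem measurableSet_ctx_eq [MeasurableSingletonClass Z] (i : Fin t) (z : Z) :
    MeasurableSet {h : Fin t → Obs A Z | (h i).2.1 = z} :=
  (measurable_fst.comp (measurable_snd.comp (measurable_pi_apply i))) (measurableSet_singleton z)

theorem measurable_rew (i : Fin t) :
    Measurable fun h : Fin t → Obs A Z => ((h i).2.2 : ℝ) := by
  fun_prop

theorem measurable_numAct [MeasurableSingletonClass A] [DecidableEq A] (a : A) :
    Measurable fun h : Fin t → Obs A Z => numAct h a :=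
  measurable_const.max <| Finset.measurable_sum _ fun i _ =>
    Measurable.ite (measurableSet_act_eq i a) measurable_const measurable_const

theorem measurable_numCtx [MeasurableSingletonClass Z] [DecidableEq Z] (z : Z) :
    Measurable fun h : Fin t → Obs A Z => numCtx h z :=
  measurable_const.max <| Finset.measurable_sum _ fun i _ =>
    Measurable.ite (measurableSet_ctx_eq i z) measurable_const measurable_const

theorem measurable_ucbAct [MeasurableSingletonClass A] [DecidableEq A] (δ : ℝ) (a : A) :
    Measurable fun h : Fin t → Obs A Z => ucbAct δ h a := by
  have h₁ := measurable_numAct (Z := Z) (t := t) a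
  refine Measurable.add (h₁.inv.mul ?_) ((measurable_const.div (measurable_const.mul h₁)).sqrt)
  exact Finset.measurable_sum _ fun i _ =>
    Measurable.ite (measurableSet_act_eq i a) (measurable_rew i) measurable_const

theorem measurable_ucbCtx [MeasurableSingletonClass Z] [DecidableEq Z] (δ : ℝ) (z : Z) :
    Measurable fun h : Fin t → Obs A Z => ucbCtx δ h z := by
  have h₁ := measurable_numCtx (A := A) (t := t) z
  refine Measurable.add (h₁.inv.mul ?_) ((measurable_const.div (measurable_const.mul h₁)).sqrt)
  exact Finset.measurable_sum _ fun i _ =>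
    Measurable.ite (measurableSet_ctx_eq i z) (measurable_rew i) measurable_const

theorem measurable_pseudoUcb [MeasurableSingletonClass Z] [DecidableEq Z] [Fintype Z]
    {Q : (Fin t → Obs A Z) → A → Z → ℝ}
    (hQ : ∀ a z, Measurable fun h => Q h a z) (δ : ℝ) (a : A) :
    Measurable fun h : Fin t → Obs A Z => pseudoUcb (Q h) δ h a :=
  Finset.measurable_sum _ fun z _ => (measurable_ucbCtx δ z).mul (hQ a z)

theorem measurable_estMarginal [MeasurableSingletonClass A] [MeasurableSingletonClass Z]
    [DecidableEq A] [DecidableEq Z] (m : ℕ) (a : A) (z : Z) :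
    Measurable fun h : Fin t → Obs A Z => estMarginal m h a z := by
  refine Measurable.div (Finset.measurable_sum _ fun i _ => ?_)
    (Finset.measurable_sum _ fun i _ => ?_)
  · exact Measurable.ite ((MeasurableSet.const _).inter
      ((measurableSet_act_eq i a).inter (measurableSet_ctx_eq i z))) measurable_const
      measurable_const
  · exact Measurable.ite ((MeasurableSet.const _).inter (measurableSet_act_eq i a))
      measurable_const measurable_const

end Measurability

section MeasurablePolicies

variable [MeasurableSpace A] [Fintype A] [LinearOrder A]

theorem measurable_argmax [Nonempty A] {X : Type*} [MeasurableSpace X] {f : X → A → ℝ}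
    (hf : ∀ a, Measurable fun x => f x a) : Measurable fun x => argmax (f x) := by
  have hmax : ∀ a, MeasurableSet {x | ∀ b, f x b ≤ f x a} := fun a =>
    measurableSet_setOf_forall fun b => measurableSet_le (hf b) (hf a)
  refine measurable_to_countable' fun a => ?_
  have : (fun x => argmax (f x)) ⁻¹' {a} =
      {x | ∀ b, f x b ≤ f x a} ∩ {x | ∀ c, (∀ b, f x b ≤ f x c) → a ≤ c} := by
    ext x
    exact argmax_eq_iff (f x) a
  rw [this]
  refine (hmax a).inter (measurableSet_setOf_forall fun c => ?_)
  by_cases hc : a ≤ c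
  · simp [hc]
  · simp only [hc, imp_false]
    exact (hmax c).compl

variable [MeasurableSingletonClass A] [Fintype Z] [DecidableEq Z] [MeasurableSpace Z]
  [MeasurableSingletonClass Z]

theorem measurable_hacMarginal (q : A → Z → ℝ) (T t : ℕ) (a : A) (z : Z) :
    Measurable fun h : Fin t → Obs A Z => hacMarginal q T h a z := by
  classical
  have hset : MeasurableSet {h : Fin t → Obs A Z |
      ∃ a, 2 * slack A Z T < ∑ z, |q a z - estMarginal (phase₁ A T) h a z|} :=
    measurableSet_setOf_exists fun a => measurableSet_lt measurable_const <|
      Finset.measurable_sum _ fun z _ =>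
        (measurable_const.sub (measurable_estMarginal _ a z)).abs
  have : (fun h : Fin t → Obs A Z => hacMarginal q T h a z) = fun h =>
      if ∃ a, 2 * slack A Z T < ∑ z, |q a z - estMarginal (phase₁ A T) h a z| then
        estMarginal (phase₁ A T) h a z else q a z := by
    funext h
    unfold hacMarginal
    split_ifs <;> rfl
  rw [this]
  exact Measurable.ite hset (measurable_estMarginal _ a z) measurable_const

theorem measurableSet_hacFlag (q : A → Z → ℝ) (T t : ℕ) :
    MeasurableSet {h : Fin t → Obs A Z | hacFlag q T h} := by
  refine measurableSet_setOf_forall fun s => measurableSet_setOf_forall fun hs =>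
    measurableSet_setOf_forall fun _ => measurableSet_setOf_forall fun a => ?_
  have hres : Measurable fun (h : Fin t → Obs A Z) (i : Fin s) => h (Fin.castLE hs i) :=
    measurable_pi_iff.2 fun i => measurable_pi_apply _
  have hQ := measurable_hacMarginal q T t
  have hgap : Measurable fun h : Fin t → Obs A Z =>
      ucbAct (2 / (T : ℝ) ^ 2) (fun i : Fin s => h (Fin.castLE hs i)) a
        - pseudoUcb (hacMarginal q T h) (2 / (T : ℝ) ^ 2)
          (fun i : Fin s => h (Fin.castLE hs i)) a + slack A Z T :=
    ((((measurable_ucbAct _ a).comp hres).sub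
      (Finset.measurable_sum _ fun z _ =>
        ((measurable_ucbCtx _ z).comp hres).mul (hQ a z))).add measurable_const)
  refine MeasurableSet.inter (measurableSet_le ?_ hgap) (measurableSet_le hgap ?_)
  · exact measurable_const.mul <| Finset.measurable_sum _ fun z _ =>
      (measurable_const.div ((measurable_numCtx z).comp hres)).sqrt.mul (hQ a z)
  · exact (measurable_const.mul
      (measurable_const.div ((measurable_numAct a).comp hres)).sqrt).add measurable_const

theorem measurable_hac [Nonempty A] (q : A → Z → ℝ) (T t : ℕ) :
    Measurable (hac q T t : (Fin t → Obs A Z) → A) := by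
  classical
  unfold hac
  split_ifs
  · exact measurable_const
  · exact measurable_const
  · exact Measurable.ite (measurableSet_hacFlag q T t)
      (measurable_argmax fun a => measurable_pseudoUcb (measurable_hacMarginal q T t) _ a)
      (measurable_argmax fun a => measurable_ucbAct _ a)

end MeasurablePolicies

end

/-! ### Exploration schedule and deterministic bounds on the estimators -/

section

variable {A Z : Type*}

section Exploration

/-- The solutions of `t / n = j` form the block `[j n, (j + 1) n)`, which lies inside the range
since `j < k`. -/
theorem card_filter_div_eq {n k j : ℕ} (hj : j < k) :
    ((Finset.range (n * k)).filter fun t => t / n = j).card = n := by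
  rcases Nat.eq_zero_or_pos n with rfl | hn
  · simp
  · have : ((Finset.range (n * k)).filter fun t => t / n = j) =
        Finset.Ico (j * n) (j * n + n) := by
      ext t
      have hle : (j + 1) * n ≤ k * n := Nat.mul_le_mul_right n hj
      simp only [Finset.mem_filter, Finset.mem_range, Finset.mem_Ico, Nat.div_eq_iff hn]
      constructor
      · rintro ⟨_, h₁, h₂⟩
        omega
      · rintro ⟨h₁, h₂⟩
        refine ⟨?_, h₁, by omega⟩
        calc t < (j + 1) * n := by linarith
          _ ≤ n * k := by linarith
    rw [this]
    simp

theorem explore₁_pos [Fintype A] [Nonempty A] {T : ℕ} (hT : 0 < T) : 0 < explore₁ A T := by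
  have : (0 : ℝ) < T := by exact_mod_cast hT
  have hA : (0 : ℝ) < Fintype.card A := by exact_mod_cast Fintype.card_pos
  exact Nat.ceil_pos.2 (by positivity)

theorem phase₁_add_phase₂ [Fintype A] (T : ℕ) :
    phase₁ A T + phase₂ A T = (explore₁ A T + explore₂ A T) * Fintype.card A := by
  simp [phase₁, phase₂, add_mul]

theorem le_explore₁_add_explore₂ [Fintype A] (T : ℕ) :
    5 * √(T : ℝ) / Fintype.card A ≤ ((explore₁ A T + explore₂ A T : ℕ) : ℝ) := by
  have h₁ := Nat.le_ceil (4 * √(T : ℝ) / Fintype.card A)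
  have h₂ := Nat.le_ceil (√(T : ℝ) / Fintype.card A)
  simp only [explore₁, explore₂, Nat.cast_add]
  calc _ = 4 * √(T : ℝ) / Fintype.card A + √(T : ℝ) / Fintype.card A := by ring
    _ ≤ _ := add_le_add h₁ h₂

theorem phase₁_add_phase₂_le [Fintype A] [Nonempty A] (T : ℕ) :
    ((phase₁ A T + phase₂ A T : ℕ) : ℝ) ≤ 5 * √(T : ℝ) + 2 * Fintype.card A := by
  have hA : (0 : ℝ) < Fintype.card A := by exact_mod_cast Fintype.card_pos
  have h₁ := (Nat.ceil_lt_add_one (by positivity : 0 ≤ 4 * √(T : ℝ) / Fintype.card A)).le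
  have h₂ := (Nat.ceil_lt_add_one (by positivity : 0 ≤ √(T : ℝ) / Fintype.card A)).le
  have h := mul_le_mul_of_nonneg_right (add_le_add h₁ h₂) hA.le
  rw [phase₁_add_phase₂, explore₁, explore₂]
  push_cast
  refine h.trans (le_of_eq ?_)
  field_simp
  ring

variable [Fintype A] [LinearOrder A] [Nonempty A]

/-- The action that HAC-UCB plays in round `t` of its exploration phases. -/
noncomputable def explorationAction (A : Type*) [Fintype A] [LinearOrder A] [Nonempty A]
    (T t : ℕ) : A :=
  if h₁ : t < phase₁ A T then
    monoEquivOfFin A rfl ⟨t / explore₁ A T, Nat.div_lt_of_lt_mul h₁⟩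
  else if h₂ : t - phase₁ A T < phase₂ A T then
    monoEquivOfFin A rfl ⟨(t - phase₁ A T) / explore₂ A T, Nat.div_lt_of_lt_mul h₂⟩
  else Classical.arbitrary A

theorem explorationAction_eq_iff₁ {T t : ℕ} (ht : t < phase₁ A T) (a : A) :
    explorationAction A T t = a ↔ t / explore₁ A T = ((monoEquivOfFin A rfl).symm a : ℕ) := by
  rw [explorationAction, dif_pos ht, ← OrderIso.eq_symm_apply, Fin.ext_iff]

theorem explorationAction_eq_iff₂ {T t : ℕ} (ht : t < phase₂ A T) (a : A) :
    explorationAction A T (phase₁ A T + t) = a ↔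
      t / explore₂ A T = ((monoEquivOfFin A rfl).symm a : ℕ) := by
  have h₁ : ¬ phase₁ A T + t < phase₁ A T := by omega
  have h₂ : phase₁ A T + t - phase₁ A T < phase₂ A T := by omega
  rw [explorationAction, dif_neg h₁, dif_pos h₂, ← OrderIso.eq_symm_apply, Fin.ext_iff]
  simp

/-- The exploration rounds in which `a` is played. -/
noncomputable def explorationRounds (T : ℕ) (a : A) : Finset ℕ :=
  (Finset.range (phase₁ A T + phase₂ A T)).filter fun t => explorationAction A T t = a

theorem card_explorationRounds (T : ℕ) (a : A) :
    (explorationRounds T a).card = explore₁ A T + explore₂ A T := by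
  have hk := ((monoEquivOfFin A rfl).symm a).isLt
  have h₁ := Finset.sum_congr (rfl : Finset.range (phase₁ A T) = _) fun t ht =>
    if_congr (explorationAction_eq_iff₁ (Finset.mem_range.1 ht) a) (rfl : 1 = 1) (rfl : 0 = 0)
  have h₂ := Finset.sum_congr (rfl : Finset.range (phase₂ A T) = _) fun t ht =>
    if_congr (explorationAction_eq_iff₂ (Finset.mem_range.1 ht) a) (rfl : 1 = 1) (rfl : 0 = 0)
  rw [explorationRounds, Finset.card_filter, Finset.sum_range_add, h₁, h₂, ← Finset.card_filter,
    ← Finset.card_filter]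
  exact congrArg₂ _ (card_filter_div_eq hk) (card_filter_div_eq hk)

theorem exists_explorationAction_eq {T : ℕ} (hT : 0 < T) (a : A) :
    ∃ t < phase₁ A T, explorationAction A T t = a := by
  have hk := ((monoEquivOfFin A rfl).symm a).isLt
  have hn := explore₁_pos (A := A) hT
  have ht : explore₁ A T * ((monoEquivOfFin A rfl).symm a : ℕ) < phase₁ A T :=
    Nat.mul_lt_mul_of_pos_left hk hn
  exact ⟨_, ht, (explorationAction_eq_iff₁ ht a).2 (Nat.mul_div_cancel_left _ hn)⟩

variable [Fintype Z] [DecidableEq Z]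

/-- Exploration ignores the data, so its context counts are sums of independent indicators over a
fixed set of rounds. -/
theorem action_hac_of_lt (q : A → Z → ℝ) {T t : ℕ} (ω : ℕ → A → Z × unitInterval)
    (ht : t < phase₁ A T + phase₂ A T) :
    action (hac q T) ω t = explorationAction A T t := by
  unfold action hac explorationAction
  split_ifs
  · rfl
  · rfl
  all_goals omega

theorem action_hac_of_not_hacFlag (q : A → Z → ℝ) {T t : ℕ} (ω : ℕ → A → Z × unitInterval)
    (ht : phase₁ A T + phase₂ A T ≤ t) (hflag : ¬ hacFlag q T (history (hac q T) ω t)) :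
    action (hac q T) ω t = argmax (ucbAct (2 / (T : ℝ) ^ 2) (history (hac q T) ω t)) := by
  unfold action
  rw [hac, dif_neg (by omega), dif_neg (by omega), if_neg hflag]
  rfl

end Exploration

section HistoryBounds

variable {t : ℕ}

/-- The condition `0 ≤ c` covers an action that was never played, whose empirical mean is 0 by
convention. For the same reason `le_meanAct` asks for at least one play. -/
theorem meanAct_le [DecidableEq A] {h : Fin t → Obs A Z} {a : A} {c : ℝ} (hc : 0 ≤ c)
    (hr : ∀ i, (h i).1 = a → ((h i).2.2 : ℝ) ≤ c) : meanAct h a ≤ c := by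
  have hN : 0 < numAct h a := lt_max_of_lt_left one_pos
  rw [meanAct, inv_mul_le_iff₀ hN]
  calc _ ≤ ∑ i, (if (h i).1 = a then 1 else 0) * c :=
        Finset.sum_le_sum fun i _ => by split_ifs with hi <;> simp [hr _, hi]
    _ ≤ numAct h a * c := by
        rw [← Finset.sum_mul]
        exact mul_le_mul_of_nonneg_right (le_max_right _ _) hc

theorem le_meanAct [DecidableEq A] {h : Fin t → Obs A Z} {a : A} {c : ℝ}
    (hN : 1 ≤ ∑ i, if (h i).1 = a then (1 : ℝ) else 0)
    (hr : ∀ i, (h i).1 = a → c ≤ ((h i).2.2 : ℝ)) : c ≤ meanAct h a := by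
  have hN' : 0 < numAct h a := lt_max_of_lt_left one_pos
  rw [meanAct, le_inv_mul_iff₀ hN', numAct, max_eq_right hN, Finset.sum_mul]
  exact Finset.sum_le_sum fun i _ => by split_ifs with hi <;> simp [hr _, hi]

/-- If `a₀` is the only action with rewards below `c`, and some other action has produced the
context `z` at least a third as often, then the empirical mean reward given `z` is at least
`c / 4`. -/
theorem le_meanCtx [DecidableEq A] [DecidableEq Z] {h : Fin t → Obs A Z} {a₀ a₁ : A} (ha : a₁ ≠ a₀)
    {z : Z} {c x : ℝ} (hc : 0 ≤ c) (hr : ∀ i, (h i).1 ≠ a₀ → c ≤ ((h i).2.2 : ℝ)) (hx : 1 ≤ x)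
    (h₁ : x ≤ ∑ i, if (h i).1 = a₁ ∧ (h i).2.1 = z then 1 else 0)
    (h₀ : (∑ i, if (h i).1 = a₀ ∧ (h i).2.1 = z then 1 else 0) ≤ 3 * x) :
    c / 4 ≤ meanCtx h z ∧ x ≤ numCtx h z := by
  have hM : (∑ i, if (h i).1 = a₁ ∧ (h i).2.1 = z then (1 : ℝ) else 0) ≤
      ∑ i, if (h i).1 ≠ a₀ ∧ (h i).2.1 = z then 1 else 0 :=
    Finset.sum_le_sum fun i _ => by
      by_cases hi : (h i).1 = a₁
      · simp [hi, ha]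
      · simp only [hi, false_and, if_false]
        split_ifs <;> simp
  have hsplit : (∑ i, if (h i).2.1 = z then (1 : ℝ) else 0) =
      (∑ i, if (h i).1 ≠ a₀ ∧ (h i).2.1 = z then 1 else 0) +
        ∑ i, if (h i).1 = a₀ ∧ (h i).2.1 = z then 1 else 0 := by
    rw [← Finset.sum_add_distrib]
    refine Finset.sum_congr rfl fun i _ => ?_
    by_cases hi : (h i).1 = a₀ <;> simp [hi]
  have hS : (∑ i, if (h i).1 ≠ a₀ ∧ (h i).2.1 = z then (1 : ℝ) else 0) * c ≤
      ∑ i, if (h i).2.1 = z then ((h i).2.2 : ℝ) else 0 := by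
    rw [Finset.sum_mul]
    refine Finset.sum_le_sum fun i _ => ?_
    have h0 : (0 : ℝ) ≤ (h i).2.2 := (h i).2.2.2.1
    by_cases hi : (h i).1 = a₀
    · simp only [hi, ne_eq, not_true_eq_false, false_and, if_false, zero_mul]
      split_ifs <;> simp [h0]
    · by_cases hz : (h i).2.1 = z <;> simp [hi, hz, hr i hi]
  have hnn : (0 : ℝ) ≤ ∑ i, if (h i).1 = a₀ ∧ (h i).2.1 = z then 1 else 0 :=
    Finset.sum_nonneg fun i _ => by split_ifs <;> simp
  have hN : numCtx h z = ∑ i, if (h i).2.1 = z then (1 : ℝ) else 0 :=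
    max_eq_right (by linarith)
  have hpos : 0 < numCtx h z := lt_max_of_lt_left one_pos
  refine ⟨?_, by rw [hN]; linarith⟩
  rw [meanCtx, le_inv_mul_iff₀ hpos]
  refine le_trans ?_ hS
  rw [hN, hsplit]
  -- If `M` observations of `z` come from actions other than `a₀`, then `x ≤ M`, so `a₀` contributes
  -- at most `3 M` and the total is at most `4 M`.
  nlinarith

theorem log_two_div_two_div_sq (x : ℝ) : Real.log (2 / (2 / x ^ 2)) = 2 * Real.log x := by
  rcases eq_or_ne x 0 with rfl | hx
  · simp
  · rw [show 2 / (2 / x ^ 2) = x ^ 2 by field_simp, Real.log_pow]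
    norm_num

theorem ucbAct_two_div_sq [DecidableEq A] (T : ℝ) (h : Fin t → Obs A Z) (a : A) :
    ucbAct (2 / T ^ 2) h a = meanAct h a + √(Real.log T / numAct h a) := by
  rw [ucbAct, log_two_div_two_div_sq, mul_div_mul_left _ _ two_ne_zero]

theorem ucbCtx_two_div_sq [DecidableEq Z] (T : ℝ) (h : Fin t → Obs A Z) (z : Z) :
    ucbCtx (2 / T ^ 2) h z = meanCtx h z + √(Real.log T / numCtx h z) := by
  rw [ucbCtx, log_two_div_two_div_sq, mul_div_mul_left _ _ two_ne_zero]

/-- Some play of `a` among the first `m` rounds is needed, since otherwise all quotients are `0 / 0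
= 0`. -/
theorem sum_estMarginal [DecidableEq A] [DecidableEq Z] [Fintype Z] {m : ℕ} {h : Fin t → Obs A Z}
    {a : A} (ha : ∃ i : Fin t, i.val < m ∧ (h i).1 = a) : ∑ z, estMarginal m h a z = 1 := by
  have hpos : (0 : ℝ) < ∑ i, if i.val < m ∧ (h i).1 = a then 1 else 0 := by
    obtain ⟨i, hi⟩ := ha
    refine Finset.sum_pos' (fun i _ => by split_ifs <;> simp) ⟨i, Finset.mem_univ _, ?_⟩
    simp [hi]
  simp only [estMarginal]
  rw [← Finset.sum_div, div_eq_one_iff_eq hpos.ne', Finset.sum_comm]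
  refine Finset.sum_congr rfl fun i _ => ?_
  by_cases hi : i.val < m ∧ (h i).1 = a
  · simp [hi]
  · have : ∀ z, ¬ (i.val < m ∧ (h i).1 = a ∧ (h i).2.1 = z) := fun z hz => hi ⟨hz.1, hz.2.1⟩
    simp [hi, this]

theorem estMarginal_nonneg [DecidableEq A] [DecidableEq Z] (m : ℕ) (h : Fin t → Obs A Z) (a : A)
    (z : Z) : 0 ≤ estMarginal m h a z :=
  div_nonneg (Finset.sum_nonneg fun i _ => by split_ifs <;> simp)
    (Finset.sum_nonneg fun i _ => by split_ifs <;> simp)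

end HistoryBounds

end

/-! ### Good outcomes: the test fails and UCB avoids `a₀` -/

section

variable {A Z : Type*} [Fintype A] [LinearOrder A] [Nonempty A] [DecidableEq Z]

/-- Number of exploration rounds in which `a` is played and produces the context `z`. -/
noncomputable def explorationCount (T : ℕ) (a : A) (z : Z) (ω : ℕ → A → Z × unitInterval) : ℝ :=
  ∑ t ∈ explorationRounds T a, if (ω t a).1 = z then 1 else 0

/-- Outcomes for which `a₀` has small and every other action has large rewards, and for which
the context frequencies in the exploration rounds of every action are comparable to `p`. -/
structure GoodOutcome (p : Z → ℝ) (a₀ : A) (T : ℕ) (ω : ℕ → A → Z × unitInterval) : Prop where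
  reward_le : ∀ t, ((ω t a₀).2 : ℝ) ≤ 1 / 8
  le_reward : ∀ t a, a ≠ a₀ → 7 / 8 ≤ ((ω t a).2 : ℝ)
  -- Relative error 1/2 keeps all counts of `z` between `n p z / 2` and three times that value, the
  -- ratio that `le_meanCtx` allows.
  count : ∀ a z, |explorationCount T a z ω - ((explore₁ A T + explore₂ A T : ℕ) : ℝ) * p z| <
    ((explore₁ A T + explore₂ A T : ℕ) : ℝ) * p z / 2

/-- The horizon is large enough for the test of HAC-UCB to detect a violation by a constant. -/
structure LargeHorizon (A Z : Type*) [Fintype A] [Fintype Z] (p₀ : ℝ) (T : ℕ) : Prop where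
  pos : 0 < T
  le_count : 1 ≤ ((explore₁ A T + explore₂ A T : ℕ) : ℝ) * p₀ / 2
  -- The threshold is the gap `7/32 - 1/8` between the context means and the action mean of `a₀`.
  bonus : √(Real.log T / ((explore₁ A T + explore₂ A T : ℕ) : ℝ)) +
    √(Real.log T / (((explore₁ A T + explore₂ A T : ℕ) : ℝ) * p₀ / 2)) + slack A Z T < 3 / 32

variable [Fintype Z] {q : A → Z → ℝ} {p : Z → ℝ} {p₀ : ℝ} {a₀ a₁ : A} {T t : ℕ}
  {ω : ℕ → A → Z × unitInterval}

theorem sum_history_exploration (a : A) (z : Z) :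
    (∑ i, if (history (hac q T) ω (phase₁ A T + phase₂ A T) i).1 = a ∧
      (history (hac q T) ω (phase₁ A T + phase₂ A T) i).2.1 = z then (1 : ℝ) else 0) =
      explorationCount T a z ω := by
  rw [sum_history (hac q T) ω _ fun _ o => if o.1 = a ∧ o.2.1 = z then (1 : ℝ) else 0,
    explorationCount, explorationRounds, Finset.sum_filter]
  refine Finset.sum_congr rfl fun s hs => ?_
  simp only [action_hac_of_lt q ω (Finset.mem_range.1 hs)]
  by_cases ha : explorationAction A T s = a <;> simp [ha]

theorem le_sum_history_act (ht : phase₁ A T + phase₂ A T ≤ t) (a : A) :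
    ((explore₁ A T + explore₂ A T : ℕ) : ℝ) ≤
      ∑ i, if (history (hac q T) ω t i).1 = a then 1 else 0 := by
  rw [sum_history (hac q T) ω _ fun _ o => if o.1 = a then (1 : ℝ) else 0,
    ← card_explorationRounds T a, explorationRounds, Finset.card_filter]
  push_cast
  refine (Finset.sum_le_sum fun s hs => le_of_eq ?_).trans
    (Finset.sum_le_sum_of_subset_of_nonneg (Finset.range_subset_range.2 ht) fun s _ _ => ?_)
  · simp only [action_hac_of_lt q ω (Finset.mem_range.1 hs)]
  · split_ifs <;> simp

theorem exists_history_act_eq (hT : 0 < T) (ht : phase₁ A T + phase₂ A T ≤ t) (a : A) :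
    ∃ i : Fin t, i.val < phase₁ A T ∧ (history (hac q T) ω t i).1 = a := by
  obtain ⟨s, hs, rfl⟩ := exists_explorationAction_eq hT a
  exact ⟨⟨s, by omega⟩, hs, by
    rw [history_apply, action_hac_of_lt q ω (by simp only; omega)]⟩

/-- The marginals that HAC-UCB uses after its exploration are probability vectors. -/
theorem hacMarginal_mem_stdSimplex (hq : ∀ a, q a ∈ stdSimplex ℝ Z) (hT : 0 < T)
    (ht : phase₁ A T + phase₂ A T ≤ t) (a : A) :
    hacMarginal q T (history (hac q T) ω t) a ∈ stdSimplex ℝ Z := by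
  unfold hacMarginal
  split_ifs
  · exact ⟨estMarginal_nonneg _ _ a, sum_estMarginal (exists_history_act_eq hT ht a)⟩
  · exact hq a

/-- The bound is uniform in `t`: the rewards of `a₀` never exceed 1/8, and exploration alone
provides the plays that control the radius. -/
theorem GoodOutcome.ucbAct_le (hω : GoodOutcome p a₀ T ω) (hT : LargeHorizon A Z p₀ T)
    (ht : phase₁ A T + phase₂ A T ≤ t) :
    ucbAct (2 / (T : ℝ) ^ 2) (history (hac q T) ω t) a₀ ≤
      1 / 8 + √(Real.log T / ((explore₁ A T + explore₂ A T : ℕ) : ℝ)) := by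
  have hn : (0 : ℝ) < ((explore₁ A T + explore₂ A T : ℕ) : ℝ) :=
    Nat.cast_pos.2 (Nat.add_pos_left (explore₁_pos hT.pos) _)
  have hlog : 0 ≤ Real.log T := Real.log_natCast_nonneg T
  rw [ucbAct_two_div_sq]
  refine add_le_add (meanAct_le (by norm_num) fun i hi => ?_) (Real.sqrt_le_sqrt ?_)
  · rw [history_apply] at hi ⊢
    simp only at hi ⊢
    rw [hi]
    exact hω.reward_le _
  · exact div_le_div_of_nonneg_left hlog hn ((le_sum_history_act ht a₀).trans (le_max_right _ _))

/-- The lower inequality of the test is violated at `a₀`. One of its two context radii cancels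
against the one inside the pseudo bound, leaving `7/32 ≤ 1/8` plus two radii and the slack, contrary
to `LargeHorizon.bonus`. Allowing any probability vector at `a₀` covers both given and estimated
marginals. -/
theorem GoodOutcome.not_hacTest (hω : GoodOutcome p a₀ T ω) (hT : LargeHorizon A Z p₀ T)
    (h₁₀ : a₁ ≠ a₀) (hp : ∀ z, p₀ ≤ p z) {Q : A → Z → ℝ} (hQ : Q a₀ ∈ stdSimplex ℝ Z) :
    ¬ hacTest Q T (history (hac q T) ω (phase₁ A T + phase₂ A T)) := by
  intro htest
  have hlow := (htest a₀).1
  set h := history (hac q T) ω (phase₁ A T + phase₂ A T) with hh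
  set n : ℝ := ((explore₁ A T + explore₂ A T : ℕ) : ℝ) with hn
  have hn0 : 0 ≤ n := Nat.cast_nonneg _
  have hlog : 0 ≤ Real.log T := Real.log_natCast_nonneg T
  have hctx : ∀ z, 7 / 32 ≤ meanCtx h z ∧ n * p₀ / 2 ≤ numCtx h z := by
    intro z
    have hle : n * p₀ / 2 ≤ n * p z / 2 := by
      have := mul_le_mul_of_nonneg_left (hp z) hn0
      linarith
    have c₀ := abs_lt.1 (hω.count a₀ z)
    have c₁ := abs_lt.1 (hω.count a₁ z)
    rw [← hn] at c₀ c₁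
    have hr : ∀ i, (h i).1 ≠ a₀ → 7 / 8 ≤ ((h i).2.2 : ℝ) := fun i hi => by
      rw [hh, history_apply] at hi ⊢
      exact hω.le_reward _ _ hi
    obtain ⟨h₁, h₂⟩ := le_meanCtx (h := h) (z := z) (c := 7 / 8) (x := n * p z / 2) h₁₀
      (by norm_num) hr (hT.le_count.trans hle)
      (by rw [hh, sum_history_exploration]; linarith) (by rw [hh, sum_history_exploration]; linarith)
    exact ⟨by linarith, hle.trans h₂⟩
  have hbonus : ∑ z, √(Real.log T / numCtx h z) * Q a₀ z ≤ √(Real.log T / (n * p₀ / 2)) := by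
    calc _ ≤ ∑ z, √(Real.log T / (n * p₀ / 2)) * Q a₀ z :=
          Finset.sum_le_sum fun z _ => mul_le_mul_of_nonneg_right (Real.sqrt_le_sqrt
            (div_le_div_of_nonneg_left hlog (one_pos.trans_le hT.le_count) (hctx z).2)) (hQ.1 z)
      _ = _ := by rw [← Finset.mul_sum, hQ.2, mul_one]
  have hmean : 7 / 32 ≤ ∑ z, meanCtx h z * Q a₀ z := by
    calc (7 / 32 : ℝ) = ∑ z, 7 / 32 * Q a₀ z := by rw [← Finset.mul_sum, hQ.2, mul_one]
      _ ≤ _ := Finset.sum_le_sum fun z _ => mul_le_mul_of_nonneg_right (hctx z).1 (hQ.1 z)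
  have hpseudo : pseudoUcb Q (2 / (T : ℝ) ^ 2) h a₀ =
      ∑ z, meanCtx h z * Q a₀ z + ∑ z, √(Real.log T / numCtx h z) * Q a₀ z := by
    simp only [pseudoUcb, ucbCtx_two_div_sq, add_mul, Finset.sum_add_distrib]
  have hucb := hω.ucbAct_le (q := q) hT le_rfl
  have := hT.bonus
  rw [hpseudo] at hlow
  rw [← hh] at hucb
  linarith

/-- On good outcomes, HAC-UCB switches to UCB at the end of its exploration. -/
theorem GoodOutcome.not_hacFlag (hω : GoodOutcome p a₀ T ω) (hT : LargeHorizon A Z p₀ T)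
    (h₁₀ : a₁ ≠ a₀) (hp : ∀ z, p₀ ≤ p z) (hq : ∀ a, q a ∈ stdSimplex ℝ Z)
    (ht : phase₁ A T + phase₂ A T ≤ t) : ¬ hacFlag q T (history (hac q T) ω t) := by
  intro hflag
  have := hflag _ ht le_rfl
  rw [history_castLE] at this
  exact hω.not_hacTest hT h₁₀ hp (hacMarginal_mem_stdSimplex hq hT.pos ht a₀) this

/-- On good outcomes, HAC-UCB does not play the suboptimal action after its exploration. -/
theorem GoodOutcome.action_hac_ne (hω : GoodOutcome p a₀ T ω) (hT : LargeHorizon A Z p₀ T)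
    (h₁₀ : a₁ ≠ a₀) (hp : ∀ z, p₀ ≤ p z) (hq : ∀ a, q a ∈ stdSimplex ℝ Z)
    (ht : phase₁ A T + phase₂ A T ≤ t) : action (hac q T) ω t ≠ a₀ := by
  rw [action_hac_of_not_hacFlag q ω ht (hω.not_hacFlag hT h₁₀ hp hq ht)]
  -- The bound of `a₀` stays below `1/8 + 3/32`, while the empirical mean of `a₁` alone is at least
  -- 7/8.
  refine argmax_ne_of_lt (b := a₁) _ ((hω.ucbAct_le hT ht).trans_lt ?_)
  have hn : (1 : ℝ) ≤ ((explore₁ A T + explore₂ A T : ℕ) : ℝ) :=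
    Nat.one_le_cast.2 (Nat.add_pos_left (explore₁_pos hT.pos) _)
  have hmean : 7 / 8 ≤ meanAct (history (hac q T) ω t) a₁ := by
    refine le_meanAct (hn.trans (le_sum_history_act ht a₁)) fun i hi => ?_
    rw [history_apply] at hi ⊢
    exact hω.le_reward _ _ (hi.trans_ne h₁₀)
  have hbonus := hT.bonus
  have hs : 0 ≤ slack A Z T := by unfold slack; positivity
  have h₁ := Real.sqrt_nonneg (Real.log T / (((explore₁ A T + explore₂ A T : ℕ) : ℝ) * p₀ / 2))
  have h₂ := Real.sqrt_nonneg (Real.log T / numAct (history (hac q T) ω t) a₁)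
  rw [ucbAct_two_div_sq]
  linarith

end

/-! ### Uninformative environments: concentration and regret -/

section

variable {A Z : Type*} [MeasurableSpace Z]

theorem sum_marginal [Fintype Z] [MeasurableSingletonClass Z] (ν : Env A Z) (a : A) :
    ∑ z, marginal ν a z = 1 := by
  have h := sum_measureReal_preimage_singleton
    (μ := (ν a : Measure (Z × unitInterval))) (f := Prod.fst) (Finset.univ : Finset Z)
    fun z _ => measurable_fst (measurableSet_singleton z)
  simpa [marginal] using h

theorem marginal_mem_stdSimplex [Fintype Z] [MeasurableSingletonClass Z] (ν : Env A Z) (a : A) :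
    marginal ν a ∈ stdSimplex ℝ Z :=
  ⟨fun _ => measureReal_nonneg, sum_marginal ν a⟩

theorem integrable_reward (ν : Env A Z) (a : A) : Integrable (fun x : Z × unitInterval => (x.2 : ℝ))
    (ν a : Measure (Z × unitInterval)) :=
  Integrable.of_bound (by fun_prop) 1 (ae_of_all _ fun x => by
    rw [Real.norm_of_nonneg x.2.2.1]
    exact x.2.2.2)

theorem meanReward_mem_Icc (ν : Env A Z) (a : A) : meanReward ν a ∈ Set.Icc (0 : ℝ) 1 := by
  refine ⟨integral_nonneg fun x => x.2.2.1, ?_⟩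
  calc meanReward ν a ≤ ∫ _, (1 : ℝ) ∂(ν a : Measure (Z × unitInterval)) :=
        integral_mono (integrable_reward ν a) (integrable_const _) fun x => x.2.2.2
    _ = 1 := by simp

section OutcomeLaw

variable [Fintype A]

instance (ν : Env A Z) : IsProbabilityMeasure (outcomeLaw ν) := by
  unfold outcomeLaw
  infer_instance

theorem measurePreserving_outcome (ν : Env A Z) (t : ℕ) (a : A) :
    MeasurePreserving (fun ω : ℕ → A → Z × unitInterval => ω t a) (outcomeLaw ν)
      (ν a : Measure (Z × unitInterval)) :=
  (measurePreserving_eval (fun a => (ν a : Measure (Z × unitInterval))) a).comp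
    (measurePreserving_eval_infinitePi
      (fun _ : ℕ => Measure.pi fun a => (ν a : Measure (Z × unitInterval))) t)

theorem iIndepFun_outcome (ν : Env A Z) (a : A) {f : Z × unitInterval → ℝ} (hf : Measurable f) :
    iIndepFun (fun (t : ℕ) (ω : ℕ → A → Z × unitInterval) => f (ω t a)) (outcomeLaw ν) :=
  iIndepFun_infinitePi (P := fun _ : ℕ => Measure.pi fun a => (ν a : Measure (Z × unitInterval)))
    (X := fun _ x => f (x a)) fun _ => hf.comp (measurable_pi_apply a)

/-- Chebyshev's inequality for the number of occurrences of a context. -/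
theorem measure_le_abs_sum_ctx_sub_le [DecidableEq Z] [MeasurableSingletonClass Z] (ν : Env A Z)
    (I : Finset ℕ) (a : A) (z : Z) {c : ℝ} (hc : 0 < c) :
    outcomeLaw ν {ω | c ≤ |(∑ t ∈ I, if (ω t a).1 = z then (1 : ℝ) else 0) -
      I.card * marginal ν a z|} ≤ ENNReal.ofReal (I.card / c ^ 2) := by
  set f : Z × unitInterval → ℝ := (Prod.fst ⁻¹' {z}).indicator 1 with hf
  have hz : MeasurableSet (Prod.fst ⁻¹' {z} : Set (Z × unitInterval)) :=
    measurable_fst (measurableSet_singleton z)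
  have hfx : ∀ x, f x = if x.1 = z then 1 else 0 := fun x => by
    by_cases hx : x.1 = z <;> simp [hf, hx]
  have hfm : Measurable f := measurable_one.indicator hz
  have hf01 : ∀ x, f x ∈ Set.Icc (0 : ℝ) 1 := fun x =>
    ⟨Set.indicator_nonneg (fun _ _ => zero_le_one) x, Set.indicator_le_self' (by simp) x⟩
  set X : ℕ → (ℕ → A → Z × unitInterval) → ℝ := fun t ω => f (ω t a) with hX
  have hXm : ∀ t, Measurable (X t) := fun t => hfm.comp (measurePreserving_outcome ν t a).measurable
  have hXL : ∀ t, MemLp (X t) 2 (outcomeLaw ν) := fun t =>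
    MemLp.of_bound (hXm t).aestronglyMeasurable 1 (ae_of_all _ fun ω => by
      rw [Real.norm_of_nonneg (hf01 _).1]
      exact (hf01 _).2)
  have hXint : ∀ t, ∫ ω, X t ω ∂outcomeLaw ν = marginal ν a z := fun t => by
    have hmp := measurePreserving_outcome ν t a
    rw [hX, ← integral_map (φ := fun ω : ℕ → A → Z × unitInterval => ω t a)
      hmp.measurable.aemeasurable hfm.aestronglyMeasurable, hmp.map_eq, hf,
      integral_indicator_one hz]
    rfl
  have hvar : Var[∑ t ∈ I, X t; outcomeLaw ν] ≤ I.card := by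
    rw [IndepFun.variance_sum (fun t _ => hXL t) fun s _ t _ hst =>
      (iIndepFun_outcome ν a hfm).indepFun hst]
    -- Each indicator has variance at most 1/4; the cruder bound 1 suffices.
    calc _ ≤ ∑ _t ∈ I, (1 : ℝ) := Finset.sum_le_sum fun t _ =>
          (variance_le_sq_of_bounded (a := 0) (b := 1) (ae_of_all _ fun ω => hf01 _)
            (hXm t).aemeasurable).trans (by norm_num)
      _ = I.card := by simp
  have hsum : ∫ ω, (∑ t ∈ I, X t) ω ∂outcomeLaw ν = I.card * marginal ν a z := by
    simp only [Finset.sum_apply]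
    rw [integral_finsetSum _ fun t _ => (hXL t).integrable one_le_two]
    simp [hXint]
  have h := meas_ge_le_variance_div_sq (memLp_finsetSum' I fun t _ => hXL t) hc
  rw [hsum] at h
  refine le_trans (le_of_eq ?_) (h.trans (ENNReal.ofReal_le_ofReal (by gcongr)))
  congr 1
  ext ω
  simp only [Finset.sum_apply, hX, hfx]

end OutcomeLaw

/-- An environment in which the contexts carry no information on the actions, and `a₀` is the
unique suboptimal action. -/
structure IsUninformative (ν : Env A Z) (a₀ : A) (p₀ : ℝ) : Prop where
  pos : 0 < p₀
  marginal_eq : ∀ a b, marginal ν a = marginal ν b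
  le_marginal : ∀ a z, p₀ ≤ marginal ν a z
  reward_le : ∀ᵐ x ∂(ν a₀ : Measure (Z × unitInterval)), (x.2 : ℝ) ≤ 1 / 8
  le_reward : ∀ a ≠ a₀, ∀ᵐ x ∂(ν a : Measure (Z × unitInterval)), 7 / 8 ≤ (x.2 : ℝ)
  -- All other actions are equally good, so a round without `a₀` costs no regret.
  meanReward_eq : ∀ a ≠ a₀, ∀ b ≠ a₀, meanReward ν a = meanReward ν b

variable {ν : Env A Z} {a₀ a₁ : A} {p₀ : ℝ}

theorem IsUninformative.meanReward_le (hν : IsUninformative ν a₀ p₀) :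
    meanReward ν a₀ ≤ 1 / 8 := by
  calc meanReward ν a₀ ≤ ∫ _, (1 / 8 : ℝ) ∂(ν a₀ : Measure (Z × unitInterval)) :=
        integral_mono_ae (integrable_reward ν a₀) (integrable_const _) hν.reward_le
    _ = 1 / 8 := by simp

theorem IsUninformative.le_meanReward (hν : IsUninformative ν a₀ p₀) (h₁₀ : a₁ ≠ a₀) :
    7 / 8 ≤ meanReward ν a₁ := by
  calc (7 / 8 : ℝ) = ∫ _, (7 / 8 : ℝ) ∂(ν a₁ : Measure (Z × unitInterval)) := by simp
    _ ≤ meanReward ν a₁ :=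
        integral_mono_ae (integrable_const _) (integrable_reward ν a₁) (hν.le_reward a₁ h₁₀)

variable [Fintype A] [Nonempty A]

theorem IsUninformative.sup'_meanReward (hν : IsUninformative ν a₀ p₀) (h₁₀ : a₁ ≠ a₀) :
    Finset.univ.sup' Finset.univ_nonempty (meanReward ν) = meanReward ν a₁ := by
  refine le_antisymm (Finset.sup'_le _ _ fun a _ => ?_) (Finset.le_sup' _ (Finset.mem_univ a₁))
  by_cases ha : a = a₀
  · have := hν.meanReward_le
    have := hν.le_meanReward h₁₀
    rw [ha]
    linarith
  · exact (hν.meanReward_eq a ha a₁ h₁₀).le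

variable [LinearOrder A] [Fintype Z] [DecidableEq Z]

/-- C-UCB has linear regret in an uninformative environment. -/
theorem IsUninformative.le_regret_cucb_div (hν : IsUninformative ν a₀ p₀) (h₁₀ : a₁ ≠ a₀)
    (h₀ : ∀ a, a₀ ≤ a) (δ : ℝ) {T : ℕ} (hT : 0 < T) :
    3 / 4 ≤ regret ν (cucb (marginal ν) δ) T / T := by
  have hT' : (0 : ℝ) < T := Nat.cast_pos.2 hT
  rw [le_div_iff₀ hT', regret, hν.sup'_meanReward h₁₀]
  simp only [action_cucb_eq_of_isLeast h₀ hν.marginal_eq]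
  have h₁ := hν.meanReward_le
  have h₂ := hν.le_meanReward h₁₀
  simp only [Finset.sum_const, Finset.card_range, nsmul_eq_mul, integral_const, probReal_univ,
    smul_eq_mul, one_mul]
  nlinarith

variable [MeasurableSingletonClass Z]

/-- The reward conditions hold almost surely, so only the counts can fail. The bound is Chebyshev at
deviation `n p z / 2`, followed by a union bound over pairs of action and context. -/
theorem IsUninformative.measure_not_goodOutcome_le (hν : IsUninformative ν a₀ p₀) {T : ℕ}
    (hT : 0 < T) :
    outcomeLaw ν {ω | ¬ GoodOutcome (marginal ν a₀) a₀ T ω} ≤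
      ENNReal.ofReal (Fintype.card A * Fintype.card Z *
        (4 / (((explore₁ A T + explore₂ A T : ℕ) : ℝ) * p₀ ^ 2))) := by
  have hn : (0 : ℝ) < ((explore₁ A T + explore₂ A T : ℕ) : ℝ) :=
    Nat.cast_pos.2 (Nat.add_pos_left (explore₁_pos hT) _)
  set n : ℝ := ((explore₁ A T + explore₂ A T : ℕ) : ℝ)
  have hlow : ∀ᵐ ω ∂outcomeLaw ν, ∀ t, ((ω t a₀).2 : ℝ) ≤ 1 / 8 := ae_all_iff.2 fun t =>
    (measurePreserving_outcome ν t a₀).quasiMeasurePreserving.ae hν.reward_le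
  have hhigh : ∀ᵐ ω ∂outcomeLaw ν, ∀ t a, a ≠ a₀ → 7 / 8 ≤ ((ω t a).2 : ℝ) :=
    ae_all_iff.2 fun t => ae_all_iff.2 fun a => by
      by_cases ha : a = a₀
      · simp [ha]
      · exact ((measurePreserving_outcome ν t a).quasiMeasurePreserving.ae
          (hν.le_reward a ha)).mono fun _ h _ => h
  set B : A × Z → Set (ℕ → A → Z × unitInterval) := fun x =>
    {ω | n * marginal ν a₀ x.2 / 2 ≤ |explorationCount T x.1 x.2 ω - n * marginal ν a₀ x.2|}
  have hB : ∀ x, outcomeLaw ν (B x) ≤ ENNReal.ofReal (4 / (n * p₀ ^ 2)) := by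
    rintro ⟨a, z⟩
    have hp := hν.le_marginal a₀ z
    have hpos : 0 < marginal ν a₀ z := hν.pos.trans_le hp
    have h := measure_le_abs_sum_ctx_sub_le ν (explorationRounds T a) a z
      (c := n * marginal ν a₀ z / 2) (by positivity)
    rw [card_explorationRounds, hν.marginal_eq a a₀] at h
    refine h.trans (ENNReal.ofReal_le_ofReal ?_)
    calc n / (n * marginal ν a₀ z / 2) ^ 2 = 4 / (n * marginal ν a₀ z ^ 2) := by
          field_simp
          norm_num
      _ ≤ 4 / (n * p₀ ^ 2) := by
          have := hν.pos
          gcongr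
  have hsub : ∀ᵐ ω ∂outcomeLaw ν,
      ω ∈ {ω | ¬ GoodOutcome (marginal ν a₀) a₀ T ω} → ω ∈ ⋃ x, B x := by
    filter_upwards [hlow, hhigh] with ω h₁ h₂ hω
    by_contra hB
    refine hω ⟨h₁, h₂, fun a z => ?_⟩
    simp only [Set.mem_iUnion, not_exists] at hB
    exact not_le.1 (hB (a, z))
  calc _ ≤ outcomeLaw ν (⋃ x, B x) := measure_mono_ae hsub
    _ ≤ ∑ x, outcomeLaw ν (B x) := measure_iUnion_fintype_le _ _
    _ ≤ ∑ _x : A × Z, ENNReal.ofReal (4 / (n * p₀ ^ 2)) := Finset.sum_le_sum fun x _ => hB x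
    _ = _ := by
      rw [Finset.sum_const, Finset.card_univ, Fintype.card_prod, nsmul_eq_mul,
        ← ENNReal.ofReal_natCast, ← ENNReal.ofReal_mul (Nat.cast_nonneg _), Nat.cast_mul]

/-- The regret of HAC-UCB is at most the length of its exploration, up to the contribution of the
outcomes that are not good. -/
theorem IsUninformative.regret_hac_le (hν : IsUninformative ν a₀ p₀) (h₁₀ : a₁ ≠ a₀) {T : ℕ}
    (hT : LargeHorizon A Z p₀ T) :
    regret ν (hac (marginal ν) T) T ≤ ((phase₁ A T + phase₂ A T : ℕ) : ℝ) +
      T * (outcomeLaw ν).real {ω | ¬ GoodOutcome (marginal ν a₀) a₀ T ω} := by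
  let _ : MeasurableSpace A := ⊤
  set f : (ℕ → A → Z × unitInterval) → ℝ := fun ω =>
    ∑ t ∈ Finset.range T, meanReward ν (action (hac (marginal ν) T) ω t) with hf
  have hfm : Measurable f := Finset.measurable_sum _ fun t _ =>
    (measurable_from_top (f := meanReward ν)).comp
      (measurable_action (measurable_hac (marginal ν) T) t)
  have hf0 : ∀ ω, 0 ≤ f ω := fun ω => Finset.sum_nonneg fun t _ => (meanReward_mem_Icc ν _).1
  have hfT : ∀ ω, f ω ≤ T := fun ω =>
    (Finset.sum_le_sum fun t _ => (meanReward_mem_Icc ν _).2).trans (by simp)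
  have hfi : Integrable f (outcomeLaw ν) :=
    Integrable.of_bound hfm.aestronglyMeasurable T (ae_of_all _ fun ω => by
      rw [Real.norm_of_nonneg (hf0 ω)]
      exact hfT ω)
  set P := phase₁ A T + phase₂ A T with hP
  set m := meanReward ν a₁ with hm
  have hm01 : m ∈ Set.Icc (0 : ℝ) 1 := meanReward_mem_Icc ν a₁
  -- A measurable hull of the same measure avoids having to show that the good outcomes form a
  -- measurable set.
  set B := toMeasurable (outcomeLaw ν) {ω | ¬ GoodOutcome (marginal ν a₀) a₀ T ω} with hB
  have hBm : MeasurableSet B := measurableSet_toMeasurable _ _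
  have hBr : (outcomeLaw ν).real B =
      (outcomeLaw ν).real {ω | ¬ GoodOutcome (marginal ν a₀) a₀ T ω} := by
    simp only [Measure.real, hB, measure_toMeasurable]
  -- Off `B` only exploration rounds lose reward, at most 1 each. On `B` the left side is at most 0,
  -- because `m ≤ 1`.
  have hpt : ∀ ω, T * m - P - T * B.indicator 1 ω ≤ f ω := by
    intro ω
    by_cases hω : ω ∈ B
    · have h₁ : (T : ℝ) * m ≤ T * 1 := mul_le_mul_of_nonneg_left hm01.2 (Nat.cast_nonneg _)
      have h₂ : (0 : ℝ) ≤ P := Nat.cast_nonneg _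
      have h₃ := hf0 ω
      simp only [Set.indicator_of_mem hω, Pi.one_apply]
      linarith
    · have hgood : GoodOutcome (marginal ν a₀) a₀ T ω := by
        by_contra h
        exact hω (subset_toMeasurable _ _ h)
      have hterm : ∀ t, m - (if t < P then 1 else 0) ≤
          meanReward ν (action (hac (marginal ν) T) ω t) := by
        intro t
        split_ifs with ht
        · linarith [hm01.2, (meanReward_mem_Icc ν (action (hac (marginal ν) T) ω t)).1]
        · have hne := hgood.action_hac_ne (q := marginal ν) hT h₁₀ (hν.le_marginal a₀)
            (marginal_mem_stdSimplex ν) (not_lt.1 ht)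
          rw [sub_zero, hm, hν.meanReward_eq _ hne a₁ h₁₀]
      have hcard : (∑ t ∈ Finset.range T, if t < P then (1 : ℝ) else 0) ≤ P := by
        rw [← Finset.sum_filter, Finset.sum_const, nsmul_one]
        refine Nat.cast_le.2 ((Finset.card_le_card fun t ht => ?_).trans
          (Finset.card_range P).le)
        exact Finset.mem_range.2 (Finset.mem_filter.1 ht).2
      have hsum := Finset.sum_le_sum fun t (_ : t ∈ Finset.range T) => hterm t
      rw [Finset.sum_sub_distrib, Finset.sum_const, Finset.card_range, nsmul_eq_mul] at hsum
      simp only [Set.indicator_of_notMem hω, mul_zero, sub_zero]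
      linarith
  have hind : Integrable (B.indicator (1 : (ℕ → A → Z × unitInterval) → ℝ)) (outcomeLaw ν) :=
    (integrable_const (1 : ℝ)).indicator hBm
  have hint := integral_mono (((integrable_const (T * m - P)).sub (hind.const_mul (T : ℝ)))) hfi hpt
  rw [integral_sub' (integrable_const _) (hind.const_mul _), integral_const_mul,
    integral_indicator_one hBm, hBr] at hint
  simp only [integral_const, probReal_univ, one_smul] at hint
  rw [regret, hν.sup'_meanReward h₁₀]
  linarith

theorem IsUninformative.hacSwitches_of_goodOutcome (hν : IsUninformative ν a₀ p₀)
    (h₁₀ : a₁ ≠ a₀) {T : ℕ} (hT : LargeHorizon A Z p₀ T) (hP : phase₁ A T + phase₂ A T < T)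
    {ω : ℕ → A → Z × unitInterval} (hω : GoodOutcome (marginal ν a₀) a₀ T ω) :
    hacSwitches (marginal ν) T ω :=
  ⟨_, hP, hω.not_hacFlag hT h₁₀ (hν.le_marginal a₀) (marginal_mem_stdSimplex ν) le_rfl⟩

end

/-! ### Large horizons -/

section Asymptotics

theorem tendsto_sqrt_natCast_atTop : Tendsto (fun T : ℕ => √(T : ℝ)) atTop atTop :=
  Real.tendsto_sqrt_atTop.comp tendsto_natCast_atTop_atTop

theorem tendsto_log_natCast_atTop : Tendsto (fun T : ℕ => Real.log T) atTop atTop :=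
  Real.tendsto_log_atTop.comp tendsto_natCast_atTop_atTop

theorem tendsto_log_div_sqrt_natCast :
    Tendsto (fun T : ℕ => Real.log T / √(T : ℝ)) atTop (𝓝 0) := by
  have h := ((isLittleO_log_rpow_atTop (r := 1 / 2) (by norm_num)).tendsto_div_nhds_zero).comp
    tendsto_natCast_atTop_atTop
  refine h.congr fun T => ?_
  simp [Real.sqrt_eq_rpow]

theorem slack_eq (A Z : Type*) [Fintype A] [Fintype Z] (T : ℕ) :
    slack A Z T = √(Fintype.card A * Fintype.card Z * (Real.log T / √(T : ℝ))) := by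
  have h : (T : ℝ) ^ (1 / 4 : ℝ) = √(√(T : ℝ)) := by
    rw [Real.sqrt_eq_rpow, Real.sqrt_eq_rpow, ← Real.rpow_mul (Nat.cast_nonneg T)]
    norm_num
  rw [slack, h, ← Real.sqrt_div', mul_div_assoc]
  exact Real.sqrt_nonneg _

theorem tendsto_slack (A Z : Type*) [Fintype A] [Fintype Z] :
    Tendsto (slack A Z) atTop (𝓝 0) := by
  have h := (tendsto_log_div_sqrt_natCast.const_mul
    ((Fintype.card A * Fintype.card Z : ℕ) : ℝ)).sqrt
  simp only [mul_zero, Real.sqrt_zero] at h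
  refine h.congr fun T => ?_
  rw [slack_eq]
  push_cast
  rfl

variable (A Z : Type*) [Fintype A] [Nonempty A] [Fintype Z]

theorem tendsto_explore₁_add_explore₂ :
    Tendsto (fun T => ((explore₁ A T + explore₂ A T : ℕ) : ℝ)) atTop atTop := by
  have hA : (0 : ℝ) < Fintype.card A := Nat.cast_pos.2 Fintype.card_pos
  exact tendsto_atTop_mono le_explore₁_add_explore₂
    ((tendsto_sqrt_natCast_atTop.const_mul_atTop (by norm_num : (0 : ℝ) < 5)).atTop_div_const hA)

theorem tendsto_log_div_explore :
    Tendsto (fun T : ℕ => Real.log T / ((explore₁ A T + explore₂ A T : ℕ) : ℝ)) atTop (𝓝 0) := by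
  have hA : (0 : ℝ) < Fintype.card A := Nat.cast_pos.2 Fintype.card_pos
  have h := tendsto_log_div_sqrt_natCast.const_mul ((Fintype.card A : ℝ) / 5)
  rw [mul_zero] at h
  refine tendsto_of_tendsto_of_tendsto_of_le_of_le' tendsto_const_nhds h
    (Eventually.of_forall fun T => by
      have := Real.log_natCast_nonneg T
      positivity) ?_
  filter_upwards [eventually_gt_atTop 0] with T hT
  have hT' : (0 : ℝ) < T := Nat.cast_pos.2 hT
  calc _ ≤ Real.log T / (5 * √(T : ℝ) / Fintype.card A) :=
        div_le_div_of_nonneg_left (Real.log_natCast_nonneg T) (by positivity)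
          (le_explore₁_add_explore₂ T)
    _ = _ := by field_simp

/-- The plays per action grow at least like `√T`, which dominates `log T`, so both radii and the
slack vanish. -/
theorem eventually_largeHorizon {p₀ : ℝ} (hp₀ : 0 < p₀) :
    ∀ᶠ T in atTop, LargeHorizon A Z p₀ T := by
  have h₁ := (tendsto_log_div_explore A).sqrt
  have h₂ := ((tendsto_log_div_explore A).mul_const (p₀ / 2)⁻¹).sqrt
  have h := (h₁.add h₂).add (tendsto_slack A Z)
  simp only [zero_mul, Real.sqrt_zero, add_zero] at h
  have hn := (tendsto_explore₁_add_explore₂ A).atTop_mul_const (half_pos hp₀)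
  filter_upwards [eventually_gt_atTop 0, h.eventually_lt_const (by norm_num : (0 : ℝ) < 3 / 32),
    hn.eventually_ge_atTop 1] with T hT hb hc
  refine ⟨hT, by rwa [mul_div_assoc], ?_⟩
  rwa [mul_div_assoc, ← div_div, div_eq_mul_inv _ (p₀ / 2)]

theorem eventually_phase₁_add_phase₂_lt :
    ∀ᶠ T in atTop, phase₁ A T + phase₂ A T < T := by
  -- With `s = √T > 5 + 2 |A|` one gets `T = s * s > 5 s + 2 |A|`, the bound on the exploration
  -- length.
  filter_upwards [tendsto_sqrt_natCast_atTop.eventually_gt_atTop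
    (5 + 2 * (Fintype.card A : ℝ))] with T hT
  have hA : (0 : ℝ) ≤ Fintype.card A := Nat.cast_nonneg _
  have hsq := Real.mul_self_sqrt (Nat.cast_nonneg (α := ℝ) T)
  have hle := phase₁_add_phase₂_le (A := A) T
  refine Nat.cast_lt.1 (hle.trans_lt ?_)
  nlinarith

end Asymptotics

/-! ### Limits of the switching probability and of the regret ratio -/

section Uninformative

variable {A Z : Type*} [Fintype A] [LinearOrder A] [Nonempty A] [Fintype Z] [DecidableEq Z]
  [MeasurableSpace Z] [MeasurableSingletonClass Z] {ν : Env A Z} {a₀ a₁ : A} {p₀ : ℝ}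

theorem IsUninformative.exists_measureReal_le (hν : IsUninformative ν a₀ p₀) :
    ∃ K : ℝ, 0 ≤ K ∧ ∀ T : ℕ, 0 < T →
      (outcomeLaw ν).real {ω | ¬ GoodOutcome (marginal ν a₀) a₀ T ω} ≤ K / √(T : ℝ) := by
  have hp := hν.pos
  have hA : (0 : ℝ) < Fintype.card A := Nat.cast_pos.2 Fintype.card_pos
  refine ⟨Fintype.card A * Fintype.card Z * (4 * Fintype.card A / (5 * p₀ ^ 2)), by positivity,
    fun T hT => ?_⟩
  have hT' : (0 : ℝ) < T := Nat.cast_pos.2 hT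
  have hle := le_explore₁_add_explore₂ (A := A) T
  calc _ ≤ Fintype.card A * Fintype.card Z *
        (4 / (((explore₁ A T + explore₂ A T : ℕ) : ℝ) * p₀ ^ 2)) :=
        ENNReal.toReal_le_of_le_ofReal (by positivity) (hν.measure_not_goodOutcome_le hT)
    _ ≤ Fintype.card A * Fintype.card Z * (4 / ((5 * √(T : ℝ) / Fintype.card A) * p₀ ^ 2)) := by
        gcongr
    _ = _ := by field_simp

theorem IsUninformative.tendsto_measure_hacSwitches (hν : IsUninformative ν a₀ p₀)
    (h₁₀ : a₁ ≠ a₀) :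
    Tendsto (fun T : ℕ => outcomeLaw ν {ω | hacSwitches (marginal ν) T ω}) atTop (𝓝 1) := by
  obtain ⟨K, -, hK⟩ := hν.exists_measureReal_le
  have hlim : Tendsto (fun T : ℕ => 1 - ENNReal.ofReal (K / √(T : ℝ))) atTop (𝓝 1) := by
    have h := ENNReal.tendsto_ofReal (tendsto_sqrt_natCast_atTop.const_div_atTop K)
    rw [ENNReal.ofReal_zero] at h
    simpa using ENNReal.Tendsto.sub tendsto_const_nhds h (Or.inl ENNReal.one_ne_top)
  refine tendsto_of_tendsto_of_tendsto_of_le_of_le' hlim tendsto_const_nhds ?_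
    (Eventually.of_forall fun T => prob_le_one)
  filter_upwards [eventually_largeHorizon A Z hν.pos, eventually_phase₁_add_phase₂_lt A]
    with T hT hP
  have hbad : outcomeLaw ν {ω | ¬ GoodOutcome (marginal ν a₀) a₀ T ω} ≤
      ENNReal.ofReal (K / √(T : ℝ)) := by
    rw [← ofReal_measureReal]
    exact ENNReal.ofReal_le_ofReal (hK T hT.pos)
  rw [tsub_le_iff_right]
  -- Subadditivity is enough here, so neither event has to be measurable.
  calc (1 : ENNReal) = outcomeLaw ν Set.univ := measure_univ.symm
    _ ≤ outcomeLaw ν ({ω | hacSwitches (marginal ν) T ω} ∪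
        {ω | ¬ GoodOutcome (marginal ν a₀) a₀ T ω}) := measure_mono fun ω _ => by
          by_cases hω : GoodOutcome (marginal ν a₀) a₀ T ω
          · exact Or.inl (hν.hacSwitches_of_goodOutcome h₁₀ hT hP hω)
          · exact Or.inr hω
    _ ≤ _ := (measure_union_le _ _).trans (by gcongr)

theorem IsUninformative.eventually_regret_hac_div_le (hν : IsUninformative ν a₀ p₀)
    (h₁₀ : a₁ ≠ a₀) :
    ∀ᶠ T : ℕ in atTop, regret ν (hac (marginal ν) T) T /
      (Fintype.card A + Fintype.card Z + √(Fintype.card A * T * Real.log T)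
        + Real.log T * √(T : ℝ)) ≤ 2 := by
  obtain ⟨K, -, hK⟩ := hν.exists_measureReal_le
  filter_upwards [eventually_largeHorizon A Z hν.pos,
    -- Once `log T ≥ 5 + K`, the term `(log T) √T` absorbs `5 √T` from exploration and `K √T` from
    -- bad outcomes. What remains is `2 |A|`, hence the ratio 2.
    tendsto_log_natCast_atTop.eventually_ge_atTop (5 + K)] with T hT hlog
  have hA : (0 : ℝ) < Fintype.card A := Nat.cast_pos.2 Fintype.card_pos
  have hZ : (0 : ℝ) ≤ Fintype.card Z := Nat.cast_nonneg _
  have hT' : (0 : ℝ) < T := Nat.cast_pos.2 hT.pos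
  have hs : 0 < √(T : ℝ) := Real.sqrt_pos.2 hT'
  have hlog0 := Real.log_natCast_nonneg T
  have hbad : T * (outcomeLaw ν).real {ω | ¬ GoodOutcome (marginal ν a₀) a₀ T ω} ≤
      K * √(T : ℝ) := by
    refine (mul_le_mul_of_nonneg_left (hK T hT.pos) hT'.le).trans (le_of_eq ?_)
    rw [mul_div_left_comm, Real.div_sqrt]
  have hreg := hν.regret_hac_le h₁₀ hT
  have hP := phase₁_add_phase₂_le (A := A) T
  have hmul := mul_le_mul_of_nonneg_right hlog hs.le
  have hroot := Real.sqrt_nonneg (Fintype.card A * T * Real.log T)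
  have hprod := mul_nonneg hlog0 hs.le
  rw [div_le_iff₀ (by positivity)]
  linarith

end Uninformative

/-! ### The uniform environment -/

section Witness

variable {A : Type*} [LinearOrder A]

/-- The scaling of the unit interval onto `[0, 1 / 8]`. -/
noncomputable def eighth (x : unitInterval) : unitInterval :=
  ⟨1 / 8, by norm_num, by norm_num⟩ * x

theorem coe_eighth_le (x : unitInterval) : (eighth x : ℝ) ≤ 1 / 8 := by
  have := x.2.2
  simp only [eighth, Set.Icc.coe_mul]
  linarith

theorem measurable_eighth : Measurable eighth :=
  (continuous_const.mul continuous_id).measurable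

/-- The scaling of the unit interval onto `[0, 1 / 8]` for `a = a₀`, and onto `[7 / 8, 1]` for
all other actions. -/
noncomputable def rewardMap (a₀ a : A) : unitInterval → unitInterval :=
  if a = a₀ then eighth else unitInterval.symm ∘ eighth

theorem measurable_rewardMap (a₀ a : A) : Measurable (rewardMap a₀ a) := by
  unfold rewardMap
  split_ifs
  · exact measurable_eighth
  · exact unitInterval.continuous_symm.measurable.comp measurable_eighth

variable {Z : Type*} [Fintype Z] [Nonempty Z] [MeasurableSpace Z] [MeasurableSingletonClass Z]

/-- The context and the reward are independent, the context is uniformly distributed, and the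
reward is uniformly distributed on `[0, 1 / 8]` for `a₀` and on `[7 / 8, 1]` for all other
actions. -/
noncomputable def uniformEnv (Z : Type*) [Fintype Z] [Nonempty Z] [MeasurableSpace Z]
    [MeasurableSingletonClass Z] (a₀ : A) : Env A Z := fun a =>
  ⟨(uniformOn (Set.univ : Set Z)).prod ((volume : Measure unitInterval).map (rewardMap a₀ a)), by
    have := isProbabilityMeasure_uniformOn (Set.finite_univ (α := Z)) Set.univ_nonempty
    have := Measure.isProbabilityMeasure_map (μ := (volume : Measure unitInterval))
      (measurable_rewardMap a₀ a).aemeasurable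
    infer_instance⟩

theorem marginal_uniformEnv (a₀ a : A) (z : Z) :
    marginal (uniformEnv Z a₀) a z = (Fintype.card Z : ℝ)⁻¹ := by
  have : IsProbabilityMeasure ((volume : Measure unitInterval).map (rewardMap a₀ a)) :=
    Measure.isProbabilityMeasure_map (measurable_rewardMap a₀ a).aemeasurable
  simp only [marginal, uniformEnv, ProbabilityMeasure.coe_mk, Measure.real, ← Set.prod_univ,
    Measure.prod_prod, measure_univ, mul_one, uniformOn_univ, Measure.count_singleton]
  simp

theorem ae_uniformEnv {a₀ a : A} {p : ℝ → Prop} (hp : MeasurableSet {x | p x})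
    (h : ∀ x, p (rewardMap a₀ a x)) :
    ∀ᵐ x ∂((uniformEnv Z a₀ a : ProbabilityMeasure _) : Measure (Z × unitInterval)), p x.2 := by
  have hmap : ∀ᵐ y : unitInterval ∂(volume : Measure unitInterval).map (rewardMap a₀ a),
      p (y : ℝ) :=
    (ae_map_iff (measurable_rewardMap a₀ a).aemeasurable (measurable_subtype_coe hp)).2
      (ae_of_all _ h)
  exact Measure.quasiMeasurePreserving_snd.ae hmap

theorem isUninformative_uniformEnv (a₀ : A) :
    IsUninformative (uniformEnv Z a₀) a₀ (Fintype.card Z : ℝ)⁻¹ where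
  pos := inv_pos.2 (Nat.cast_pos.2 Fintype.card_pos)
  marginal_eq a b := by
    funext z
    rw [marginal_uniformEnv, marginal_uniformEnv]
  le_marginal a z := (marginal_uniformEnv a₀ a z).ge
  reward_le := ae_uniformEnv measurableSet_Iic fun x => by
    rw [rewardMap, if_pos rfl]
    exact coe_eighth_le x
  le_reward a ha := ae_uniformEnv measurableSet_Ici fun x => by
    rw [rewardMap, if_neg ha, Function.comp_apply, unitInterval.coe_symm_eq]
    linarith [coe_eighth_le x]
  meanReward_eq a ha b hb := by
    simp only [meanReward, uniformEnv, rewardMap, if_neg ha, if_neg hb]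

end Witness

end CausalBandit

open CausalBandit
theorem mainTheorem4 :
    ∃ C : ℝ, 0 < C ∧
      ∀ (A : Type*) (Z : Type*) [Fintype A] [LinearOrder A] [Nonempty A]
        [Fintype Z] [DecidableEq Z] [Nonempty Z] [MeasurableSpace Z] [MeasurableSingletonClass Z],
        2 ≤ Fintype.card A →
        ∃ ν : Env A Z,
          (∀ δ : ℕ → ℝ, (∀ T, 0 < δ T ∧ δ T < 1) →
            ((1 / C : ℝ) : EReal) ≤
              liminf (fun T : ℕ => ((regret ν (cucb (marginal ν) (δ T)) T / T : ℝ) : EReal))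
                atTop) ∧
          Tendsto (fun T : ℕ => outcomeLaw ν {ω | hacSwitches (marginal ν) T ω}) atTop (𝓝 1) ∧
          limsup (fun T : ℕ =>
              ((regret ν (hac (marginal ν) T) T /
                (Fintype.card A + Fintype.card Z + √(Fintype.card A * T * Real.log T)
                  + Real.log T * √(T : ℝ)) : ℝ) : EReal)) atTop
            ≤ (C : EReal) := by
  refine ⟨2, two_pos, fun A Z _ _ _ _ _ _ _ _ hA => ?_⟩
  -- The bad action has to be the least one, since ties are broken in its favour.
  obtain ⟨a₀, h₀⟩ := Finite.exists_min (id : A → A)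
  obtain ⟨a₁, h₁₀⟩ := Fintype.exists_ne_of_one_lt_card hA a₀
  have hν := isUninformative_uniformEnv (Z := Z) a₀
  refine ⟨uniformEnv Z a₀, fun δ _ => ?_, hν.tendsto_measure_hacSwitches h₁₀, ?_⟩
  · refine le_liminf_of_le (by isBoundedDefault) ?_
    filter_upwards [eventually_gt_atTop 0] with T hT
    have := hν.le_regret_cucb_div h₁₀ h₀ (δ T) hT
    exact EReal.coe_le_coe_iff.2 (by linarith)
  · refine limsup_le_of_le (by isBoundedDefault) ?_
    filter_upwards [hν.eventually_regret_hac_div_le h₁₀] with T hT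
    exact EReal.coe_le_coe_iff.2 hT
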